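/- Let $\sigma$ be a relational vocabulary (all arities positive) and $k$ a positive integer, and write $\mathbf{k}=\{1,\dots,k\}$. For all (possibly infinite, possibly empty) $\sigma$-structures $\mathscr{A},\mathscr{B}$: \[ \mathscr{A}\equiv^{\mathcal{L}^k}\mathscr{B}\iff \mathscr{A}\leftrightarrow^{\mathbb{P}}_k\mathscr{B}. \] Here $\mathscr{A}\equiv^{\mathcal{L}^k}\mathscr{B}$ means that $\mathscr{A}$ and $\mathscr{B}$ satisfy the same sentences of $k$-variable infinitary logic with equality, i.e. the sentences of $\mathcal{L}_{\infty,\omega}$ (first-order logic with conjunctions and disjunctions over arbitrary sets) in which only the variables $x_1,\dots,x_k$ occur (these may be re-quantified). The relation $\leftrightarrow^{\mathbb{P}}_k$ is defined as follows. Let $\sigma^+=\sigma\cup\{I\}$ with $I$ a new binary symbol. * A forest order is a partial order in which the set of predecessors of each element is a finite chain. The category $\mathcal{R}^P_k(\sigma^+)$ has as objects the $\sigma^+$-structures $X$ with a forest order $\le$ and a function $p:X\to\mathbf{k}$ such that, whenever two distinct elements $a,b$ occur together in a tuple of some relation of $X$, they are comparable, and if moreover $a<b$ then $p(a)\ne p(x)$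 for all $a<x\le b$. Its morphisms are the $\sigma^+$-homomorphisms that preserve minimal elements, the covering relation, and $p$. A morphism is an embedding if it is injective and reflects all relations of $\sigma^+$. * For a $\sigma$-structure $\mathscr{A}$, $F_k\mathscr{A}$ is the object of $\mathcal{R}^P_k(\sigma^+)$ given by the pebbling comonad: its elements are the finite non-empty sequences over $\mathbf{k}\times A$, ordered by prefix; $p(s)$ is the pebble index of the last entry of $s$, and $\varepsilon(s)\in A$ is the element in the last entry of $s$. For $R\in\sigma^+$, $R(s_1,\dots,s_n)$ holds iff the $s_i$ are pairwise prefix-comparable, the index $p(s_i)$ does not occur in the suffix of $s_i$ in $s_j$ whenever $s_i$ is a prefix of $s_j$, and $R^{\mathscr{A}}(\varepsilon(s_1),\dots,\varepsilon(s_n))$, where $I^{\mathscr{A}}$ is the identity relation on $A$. * A path is an object of $\mathcal{R}^P_k(\sigma^+)$ (possibly empty) whose order is linear and in which $I$ is the identity relation; a path embedding is an embedding whose domain is a path. A morphism $f:X\to Y$ is a pathwise embedding if $f\circ e$ is an embedding for every path embedding $e:P\to X$. It is open if for all paths $P,Q$ and embeddings $i:P\to Q$, $e:P\to X$, $e':Q\to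 Y$ with $f\circ e=e'\circ i$ there is an embedding $d:Q\to X$ with $d\circ i=e$ and $f\circ d=e'$. Then $\mathscr{A}\leftrightarrow^{\mathbb{P}}_k\mathscr{B}$ means that there are an object $\mathscr{R}$ of $\mathcal{R}^P_k(\sigma^+)$ and open pathwise embeddings $\mathscr{R}\to F_k\mathscr{A}$ and $\mathscr{R}\to F_k\mathscr{B}$. -/

import Mathlib

open scoped FirstOrder
open CategoryTheory

universe u v w

namespace PebbleGame

/-! ### The `k`-variable fragment of `L_{∞,ω}` -/

/-- Formulas of the `k`-variable infinitary logic over a relational vocabulary `L`, with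
variables `x_i`, `i : Fin k` (each of which may be re-quantified), and with conjunctions and
disjunctions over arbitrary index sets. `KFormula L k S` consists of those formulas whose free
variables lie in `S`. -/
inductive KFormula (L : FirstOrder.Language.{w, v}) (k : ℕ) : Set (Fin k) → Type (max v (u + 1))
  | equal {S : Set (Fin k)} (i j : S) : KFormula L k S
  | rel {S : Set (Fin k)} {n : ℕ} (R : L.Relations n) (x : Fin n → S) : KFormula L k S
  | neg {S : Set (Fin k)} (φ : KFormula L k S) : KFormula L k S
  | conj {S : Set (Fin k)} {ι : Type u} (φ : ι → KFormula L k S) : KFormula L k S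
  | disj {S : Set (Fin k)} {ι : Type u} (φ : ι → KFormula L k S) : KFormula L k S
  | ex {S : Set (Fin k)} (i : Fin k) (φ : KFormula L k (insert i S)) : KFormula L k S
  | all {S : Set (Fin k)} (i : Fin k) (φ : KFormula L k (insert i S)) : KFormula L k S

open Classical in
/-- The assignment `v[x_i ↦ a]`. -/
noncomputable def assign {k : ℕ} {A : Type*} {S : Set (Fin k)} (v : S → A) (i : Fin k) (a : A) :
    ↥(insert i S : Set (Fin k)) → A :=
  fun j => if h : (j : Fin k) = i then a else v ⟨j, (Set.mem_insert_iff.mp j.2).resolve_left h⟩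

/-- Satisfaction of a formula under an assignment of its (potentially) free variables. -/
def KFormula.Realize {L : FirstOrder.Language.{w, v}} {k : ℕ} (A : Type*) [L.Structure A] :
    {S : Set (Fin k)} → KFormula.{u} L k S → (S → A) → Prop
  | _, .equal i j, v => v i = v j
  | _, .rel R x, v => FirstOrder.Language.Structure.RelMap R (fun i => v (x i))
  | _, .neg φ, v => ¬ φ.Realize A v
  | _, .conj φ, v => ∀ i, (φ i).Realize A v
  | _, .disj φ, v => ∃ i, (φ i).Realize A v
  | _, .ex i φ, v => ∃ a : A, φ.Realize A (assign v i a)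
  | _, .all i φ, v => ∀ a : A, φ.Realize A (assign v i a)

/-- Sentences of `k`-variable infinitary logic. -/
abbrev KSentence (L : FirstOrder.Language.{w, v}) (k : ℕ) : Type (max v (u + 1)) :=
  KFormula.{u} L k ∅

/-- `A ⊨ φ` for a sentence `φ` (`A` may be empty). -/
def KSentence.Holds {L : FirstOrder.Language.{w, v}} {k : ℕ} (A : Type*) [L.Structure A]
    (φ : KSentence.{u} L k) : Prop :=
  KFormula.Realize A φ (fun i => False.elim i.2)

/-- `A` and `B` satisfy the same sentences of `k`-variable infinitary logic. -/
def KEquivalent (L : FirstOrder.Language.{w, v}) (k : ℕ) (A B : Type u)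
    [L.Structure A] [L.Structure B] : Prop :=
  ∀ φ : KSentence.{u} L k, φ.Holds A ↔ φ.Holds B

/-! ### `k`-pebble tree-ordered structures -/

/-- The Gaifman graph of a relational structure. -/
def gaifman (L : FirstOrder.Language.{w, v}) (A : Type u) [L.Structure A] : SimpleGraph A where
  Adj a b := a ≠ b ∧ ∃ (n : ℕ) (R : L.Relations n) (x : Fin n → A),
    FirstOrder.Language.Structure.RelMap R x ∧ ∃ i j, x i = a ∧ x j = b
  symm := ⟨fun _ _ ⟨hne, n, R, x, hR, i, j, hi, hj⟩ => ⟨hne.symm, n, R, x, hR, j, i, hj, hi⟩⟩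
  loopless := ⟨fun _ h => h.1 rfl⟩

/-- A forest order: the predecessors of any element form a finite chain. -/
def IsForestOrder (A : Type u) [PartialOrder A] : Prop :=
  ∀ x : A, (Set.Iic x).Finite ∧ IsChain (· ≤ ·) (Set.Iic x)

/-- A `k`-pebble tree-ordered `L`-structure: an `L`-structure with a forest order and a pebbling
function such that Gaifman-adjacent elements are comparable, and the pebble of the smaller one is
not reused in between. -/
structure PebbleForest (L : FirstOrder.Language.{w, v}) (k : ℕ) where
  carrier : Type u
  [str : L.Structure carrier]
  [order : PartialOrder carrier]
  pebble : carrier → Fin k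
  forest : IsForestOrder carrier
  comparable : ∀ a b : carrier, (gaifman L carrier).Adj a b → a ≤ b ∨ b ≤ a
  pebble_ne : ∀ a b : carrier, (gaifman L carrier).Adj a b → a < b →
    ∀ x ∈ Set.Ioc a b, pebble a ≠ pebble x

namespace PebbleForest

variable {L : FirstOrder.Language.{w, v}} {k : ℕ}

instance : CoeSort (PebbleForest.{u} L k) (Type u) := ⟨carrier⟩

instance (X : PebbleForest.{u} L k) : L.Structure X := X.str

instance (X : PebbleForest.{u} L k) : PartialOrder X := X.order

/-- Morphisms: homomorphisms preserving roots, the covering relation and the pebbling. -/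
@[ext]
structure Hom (X Y : PebbleForest.{u} L k) where
  toHom : X →[L] Y
  map_root : ∀ x : X, IsMin x → IsMin (toHom x)
  map_covBy : ∀ x y : X, x ⋖ y → toHom x ⋖ toHom y
  map_pebble : ∀ x : X, Y.pebble (toHom x) = X.pebble x

/-- The category of `k`-pebble tree-ordered `L`-structures. -/
instance : Category (PebbleForest.{u} L k) where
  Hom := Hom
  id X := ⟨FirstOrder.Language.Hom.id L X, fun _ h => h, fun _ _ h => h, fun _ => rfl⟩
  comp f g := ⟨g.toHom.comp f.toHom, fun x h => g.map_root _ (f.map_root x h),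
    fun x y h => g.map_covBy _ _ (f.map_covBy x y h),
    fun x => (g.map_pebble _).trans (f.map_pebble x)⟩

/-- An embedding: the underlying homomorphism is injective and strong. -/
def IsEmbedding {X Y : PebbleForest.{u} L k} (f : X ⟶ Y) : Prop :=
  Function.Injective f.toHom ∧ ∀ (n : ℕ) (R : L.Relations n) (x : Fin n → X),
    FirstOrder.Language.Structure.RelMap R (fun i => f.toHom (x i)) →
      FirstOrder.Language.Structure.RelMap R x

end PebbleForest

/-! ### The pebbling comonad, as the right adjoint into pebble tree-ordered structures -/

/-- Plays: non-empty finite sequences of moves `(p, a)`. -/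
@[ext]
structure Play (k : ℕ) (A : Type u) where
  moves : List (Fin k × A)
  nonempty : moves ≠ []

namespace Play

variable {k : ℕ} {A : Type u}

/-- The pebble index of the last move. -/
def pebble (s : Play k A) : Fin k := (s.moves.getLast s.nonempty).1

/-- The counit: the element chosen in the last move. -/
def elem (s : Play k A) : A := (s.moves.getLast s.nonempty).2

/-- The prefix order on plays. -/
instance : PartialOrder (Play k A) where
  le s t := s.moves <+: t.moves
  le_refl s := List.prefix_refl s.moves
  le_trans _ _ _ h h' := h.trans h'
  le_antisymm _ _ h h' := Play.ext (h.eq_of_length (le_antisymm h.length_le h'.length_le))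

/-- The interpretation of relation symbols on plays: the plays are pairwise comparable,
the last pebble of each of them is not moved again in the suffix leading to any larger one,
and the elements chosen last are related. -/
instance (L : FirstOrder.Language.{w, v}) [L.IsRelational] [L.Structure A] :
    L.Structure (Play k A) where
  funMap f := isEmptyElim f
  RelMap R s := (∀ i j, s i ≤ s j ∨ s j ≤ s i) ∧
    (∀ i j, ∀ l : List (Fin k × A), (s j).moves = (s i).moves ++ l →
      ∀ m ∈ l, m.1 ≠ (s i).pebble) ∧
    FirstOrder.Language.Structure.RelMap R (fun i => (s i).elem)

end Play

/-- The right adjoint of the forgetful functor from `k`-pebble tree-ordered `L`-structures to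
`L`-structures, on objects: the plays with the prefix order and the last pebble index. -/
def cofree (L : FirstOrder.Language.{w, v}) [L.IsRelational] (k : ℕ) (A : Type u) [L.Structure A] :
    PebbleForest.{u} L k where
  carrier := Play k A
  pebble := Play.pebble
  forest s := by
    refine ⟨?_, fun a ha b hb _ => List.prefix_or_prefix_of_prefix ha hb⟩
    refine Set.Finite.of_finite_image (f := Play.moves) ?_ (fun a _ b _ h => Play.ext h)
    refine (List.finite_toSet s.moves.inits).subset ?_
    rintro _ ⟨t, ht, rfl⟩
    exact List.mem_inits _ _ |>.mpr ht
  comparable := by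
    rintro _ _ ⟨-, n, R, x, hR, i, j, rfl, rfl⟩
    exact hR.1 i j
  pebble_ne := by
    rintro _ _ ⟨-, n, R, x, hR, i, j, rfl, rfl⟩ - y ⟨hy, hy'⟩ h
    obtain ⟨l, hl⟩ := hy.le
    obtain ⟨l', hl'⟩ := hy'
    have hne : l ≠ [] := by
      rintro rfl
      exact hy.ne (Play.ext (by simpa using hl))
    have hlast : y.moves.getLast y.nonempty = l.getLast hne := by
      simp only [← hl, List.getLast_append_of_ne_nil _ hne]
    refine hR.2.1 i j (l ++ l') (by rw [← List.append_assoc, hl, hl']) (l.getLast hne)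
      (List.mem_append_left _ (List.getLast_mem hne)) ?_
    rw [h, Play.pebble, hlast]

/-! ### The identity symbol `I` -/

/-- The relation symbols of the vocabulary with one binary symbol `I`. -/
inductive IdSymbol : ℕ → Type
  | I : IdSymbol 2

/-- The vocabulary `{I}`. -/
def idLanguage : FirstOrder.Language.{0, 0} := ⟨fun _ => Empty, IdSymbol⟩

instance : idLanguage.IsRelational := fun _ => inferInstanceAs (IsEmpty Empty)

/-- The vocabulary `L ∪ {I}`, for a new binary symbol `I`. -/
abbrev plus (L : FirstOrder.Language.{w, v}) : FirstOrder.Language.{w, v} :=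
  L.sum idLanguage

/-- The symbol `I` of `plus L`. -/
def symI (L : FirstOrder.Language.{w, v}) : (plus L).Relations 2 := Sum.inr IdSymbol.I

/-- The `L ∪ {I}`-structure that expands the `L`-structure `A` by the identity relation. -/
@[reducible]
def expandI (L : FirstOrder.Language.{w, v}) (A : Type u) [L.Structure A] : (plus L).Structure A :=
  letI : idLanguage.Structure A :=
    { funMap := fun f => Empty.elim f
      RelMap := fun {_} R => match R with
        | IdSymbol.I => fun x => x 0 = x 1 }
  inferInstance

/-- The relative right adjoint: the `k`-pebble tree-ordered `L ∪ {I}`-structure of plays on `A`,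
where `I` is the identity relation on `A`. -/
def plays (L : FirstOrder.Language.{w, v}) [L.IsRelational] (k : ℕ) (A : Type u) [L.Structure A] :
    PebbleForest.{u} (plus L) k :=
  letI := expandI L A
  cofree (plus L) k A

/-! ### Open pathwise embeddings -/

section Open

variable {L : FirstOrder.Language.{w, v}} {k : ℕ}

/-- A path: the order is linear, i.e. it has a single branch (which is empty for the path
consisting only of the root that is implicitly adjoined to a forest), and `I` is interpreted as
the identity relation. -/
def IsPath (P : PebbleForest.{u} (plus L) k) : Prop :=
  (∀ x y : P, x ≤ y ∨ y ≤ x) ∧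
    ∀ x y : P, FirstOrder.Language.Structure.RelMap (symI L) ![x, y] ↔ x = y

/-- Composition with `f` turns path embeddings into path embeddings. -/
def IsPathwiseEmbedding {X Y : PebbleForest.{u} (plus L) k} (f : X ⟶ Y) : Prop :=
  ∀ (P : PebbleForest.{u} (plus L) k) (e : P ⟶ X), IsPath P →
    PebbleForest.IsEmbedding e → PebbleForest.IsEmbedding (e ≫ f)

/-- The path-lifting property: any commuting square `P ↣ Q`, `P ↣ X`, `Q ↣ Y`, `f : X ⟶ Y` with
`P`, `Q` paths has a diagonal filler `Q ↣ X`. -/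
def IsOpenMorphism {X Y : PebbleForest.{u} (plus L) k} (f : X ⟶ Y) : Prop :=
  ∀ (P Q : PebbleForest.{u} (plus L) k) (i : P ⟶ Q) (e : P ⟶ X) (e' : Q ⟶ Y),
    IsPath P → IsPath Q → PebbleForest.IsEmbedding i → PebbleForest.IsEmbedding e →
    PebbleForest.IsEmbedding e' → e ≫ f = i ≫ e' →
    ∃ d : Q ⟶ X, PebbleForest.IsEmbedding d ∧ i ≫ d = e ∧ d ≫ f = e'

end Open

/-- Back-and-forth equivalence for the pebbling comonad: there is a span of open pathwise
embeddings between the pebble tree-ordered structures of plays on `A` and on `B`. -/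
def BackAndForth (L : FirstOrder.Language.{w, v}) [L.IsRelational] (k : ℕ) (A B : Type u)
    [L.Structure A] [L.Structure B] : Prop :=
  ∃ (R : PebbleForest.{u} (plus L) k) (p : R ⟶ plays L k A) (q : R ⟶ plays L k B),
    IsOpenMorphism p ∧ IsPathwiseEmbedding p ∧ IsOpenMorphism q ∧ IsPathwiseEmbedding q

end PebbleGame

/-! The middle object of a span records joint runs of the `k`-pebble game on `A` and `B`, and
openness of the two legs says that a move on either side can be answered on the other.

From equivalence to a span: take the plays on `A × B` such that, after each initial segment, the
positions on `A` and on `B` satisfy the same formulas (`SameType`). A move `a` with pebble `r` can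
always be answered (`exists_assign_realize_iff`): if every answer `b` were refuted by some formula
`φ b`, then `∃ x_r, ⋀ b, φ b` would distinguish the positions. Agreement on atomic formulas makes
the projections reflect relations between elements of one position. `IsLiftingSystem` isolates these
two properties, answering and reflection, and any projection with them is an open pathwise
embedding.

From a span to equivalence: a path in `R` is at once a play on `A` and a play on `B`. As both legs
are pathwise embeddings, corresponding pebbles stand in the same relations, including `I`
(`Reaches.relMap_iff`). Openness prolongs the path by a new move
(`Reaches.exists_append_singleton`), but only if the longer play is again a path. Since `I` must be
the identity on paths, a second pebble may not be put on an occupied element. Hence variables are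
not tied to pebbles: a map `ρ`, possibly not injective, tells which pebble carries the value of each
variable. A variable that takes an occupied value is redirected to the pebble there; for a fresh
value, some pebble is unused by the other variables. Induction on formulas concludes. -/

namespace PebbleGame

open FirstOrder.Language Structure

/-! ### Pebble forests: morphisms and lower sets -/

namespace PebbleForest

variable {L : FirstOrder.Language.{w, v}} {k : ℕ}

/-- A forest order is locally finite. -/
noncomputable abbrev locallyFiniteOrder (X : PebbleForest.{u} L k) : LocallyFiniteOrder X :=
  LocallyFiniteOrder.ofFiniteIcc fun _ b => (X.forest b).1.subset Set.Icc_subset_Iic_self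

theorem le_or_le {X : PebbleForest.{u} L k} {x y z : X} (hx : x ≤ z) (hy : y ≤ z) :
    x ≤ y ∨ y ≤ x :=
  (X.forest z).2.total hx hy

/-- Well-founded induction on the number of predecessors, which is finite in a forest order. -/
theorem induction_lt {X : PebbleForest.{u} L k} {motive : X → Prop}
    (ih : ∀ x, (∀ y < x, motive y) → motive x) (x : X) : motive x := by
  have key : ∀ n : ℕ, ∀ x : X, (Set.Iic x).ncard < n → motive x := by
    intro n
    induction n with
    | zero => exact fun x hx => absurd hx (Nat.not_lt_zero _)
    | succ n hn =>
      refine fun x hx => ih x fun y hy => hn y ?_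
      exact (Set.ncard_lt_ncard (Set.Iic_ssubset_Iic.2 hy) (X.forest x).1).trans_le
        (Nat.lt_succ_iff.1 hx)
  exact key _ x (Nat.lt_succ_self _)

theorem exists_le_covBy {X : PebbleForest.{u} L k} {x y : X} (h : x < y) :
    ∃ z, x ≤ z ∧ z ⋖ y := by
  let := X.locallyFiniteOrder
  obtain ⟨z, hz, hzy⟩ := Relation.TransGen.tail'_iff.1 (lt_iff_transGen_covBy.1 h)
  exact ⟨z, le_iff_reflTransGen_covBy.2 hz, hzy⟩

/-- Morphisms are only required to preserve covers, but in a forest order every strict inequality is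
a finite chain of covers. -/
theorem hom_strictMono {X Y : PebbleForest.{u} L k} (f : X ⟶ Y) : StrictMono f.toHom := by
  intro x y h
  induction y using induction_lt with
  | ih y ih =>
    obtain ⟨z, hxz, hzy⟩ := exists_le_covBy h
    have hlt := (f.map_covBy z y hzy).lt
    rcases hxz.eq_or_lt with rfl | hxz
    · exact hlt
    · exact (ih z hzy.lt hxz).trans hlt

theorem hom_mono {X Y : PebbleForest.{u} L k} (f : X ⟶ Y) {x y : X} (h : x ≤ y) :
    f.toHom x ≤ f.toHom y :=
  (hom_strictMono f).monotone h

/-- Roots go to roots and covers to covers, so heights are preserved and the branch below `x` maps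
onto the whole branch below its image. -/
theorem exists_le_map_eq {X Y : PebbleForest.{u} L k} (f : X ⟶ Y) {x : X} {y : Y}
    (h : y ≤ f.toHom x) : ∃ z ≤ x, f.toHom z = y := by
  induction x using induction_lt with
  | ih x ih =>
    rcases h.eq_or_lt with rfl | h
    · exact ⟨x, le_rfl, rfl⟩
    have hx : ¬ IsMin x := fun hx => (f.map_root x hx).not_lt h
    obtain ⟨w, hw⟩ := not_isMin_iff.1 hx
    obtain ⟨z, -, hzx⟩ := exists_le_covBy hw
    have hc := f.map_covBy z x hzx
    rcases le_or_le h.le hc.le with hy | hy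
    · obtain ⟨z', hz', rfl⟩ := ih z hzx.lt hy
      exact ⟨z', hz'.trans hzx.le, rfl⟩
    · refine ⟨z, hzx.le, ?_⟩
      rcases hy.eq_or_lt with hy | hy
      · exact hy
      · exact absurd h (hc.2 hy)

theorem IsEmbedding.of_comp {X Y Z : PebbleForest.{u} L k} {f : X ⟶ Y} {g : Y ⟶ Z}
    (h : IsEmbedding (f ≫ g)) : IsEmbedding f :=
  ⟨Function.Injective.of_comp (f := g.toHom) h.1,
    fun n R x hR => h.2 n R x (g.toHom.map_rel R _ hR)⟩

variable [L.IsRelational]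

instance (X : PebbleForest.{u} L k) (T : LowerSet X) : L.Structure T where
  funMap f := isEmptyElim f
  RelMap R x := RelMap R fun i => (x i : X)

/-- The restriction of a pebble forest to a lower set. -/
def sub (X : PebbleForest.{u} L k) (T : LowerSet X) : PebbleForest.{u} L k where
  carrier := T
  pebble x := X.pebble x
  forest x := by
    refine ⟨Set.Finite.of_finite_image (f := Subtype.val) ((X.forest x).1.subset ?_)
      Subtype.val_injective.injOn, fun a ha b hb _ => le_or_le (X := X) (z := x) ha hb⟩
    rintro _ ⟨y, hy, rfl⟩
    exact hy
  comparable := by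
    rintro a b ⟨hne, n, R, x, hR, i, j, rfl, rfl⟩
    exact X.comparable _ _ ⟨fun h => hne (Subtype.ext h), n, R, _, hR, i, j, rfl, rfl⟩
  pebble_ne := by
    rintro a b ⟨hne, n, R, x, hR, i, j, rfl, rfl⟩ hab y hy
    exact X.pebble_ne _ _ ⟨fun h => hne (Subtype.ext h), n, R, _, hR, i, j, rfl, rfl⟩ hab y hy

variable {X Y : PebbleForest.{u} L k} {T : LowerSet X}

theorem isMin_sub {x : X.sub T} : IsMin x ↔ IsMin (x.1 : X) :=
  ⟨fun h y hy => @h ⟨y, T.lower hy x.2⟩ hy, fun h y hy => @h y.1 hy⟩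

theorem covBy_sub {x y : X.sub T} : x ⋖ y ↔ (x.1 : X) ⋖ y.1 :=
  ⟨fun h => ⟨h.1, fun z hz hzy => @h.2 ⟨z, T.lower hzy.le y.2⟩ hz hzy⟩,
    fun h => ⟨h.1, fun z hz hzy => @h.2 z.1 hz hzy⟩⟩

/-- The inclusion of a lower set. -/
def incl (X : PebbleForest.{u} L k) (T : LowerSet X) : X.sub T ⟶ X where
  toHom :=
    { toFun := fun x => x.1
      map_fun' := fun f => isEmptyElim f
      map_rel' := fun _ _ h => h }
  map_root _ h := isMin_sub.1 h
  map_covBy _ _ h := covBy_sub.1 h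
  map_pebble _ := rfl

theorem isEmbedding_incl : IsEmbedding (X.incl T) :=
  ⟨Subtype.val_injective, fun _ _ _ h => h⟩

/-- A morphism with values in a lower set, as a morphism to its restriction. -/
def lift (T : LowerSet X) (f : Y ⟶ X) (hf : ∀ y, f.toHom y ∈ T) : Y ⟶ X.sub T where
  toHom :=
    { toFun := fun y => (⟨f.toHom y, hf y⟩ : T)
      map_fun' := fun f => isEmptyElim f
      map_rel' := fun R x h => f.toHom.map_rel R x h }
  map_root y h := isMin_sub.2 (f.map_root y h)
  map_covBy x y h := covBy_sub.2 (f.map_covBy x y h)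
  map_pebble y := f.map_pebble y

end PebbleForest

/-! ### Plays and positions -/

/-- The position reached by a list of moves: which pebble is where. -/
def position {k : ℕ} {A : Type*} (m : List (Fin k × A)) : Fin k → Option A :=
  m.foldl (fun v x => Function.update v x.1 (some x.2)) fun _ => none

section Position

variable {k : ℕ} {A : Type*}

@[simp]
theorem position_nil (i : Fin k) : position ([] : List (Fin k × A)) i = none := rfl

theorem position_append_singleton (m : List (Fin k × A)) (x : Fin k × A) :
    position (m ++ [x]) = Function.update (position m) x.1 (some x.2) := by
  simp [position]

theorem position_append_of_forall_ne (m : List (Fin k × A)) {l : List (Fin k × A)} {i : Fin k}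
    (h : ∀ x ∈ l, x.1 ≠ i) : position (m ++ l) i = position m i := by
  induction l using List.reverseRecOn with
  | nil => simp
  | append_singleton l x ih =>
    rw [← List.append_assoc, position_append_singleton,
      Function.update_of_ne (h x (by simp)).symm]
    exact ih fun y hy => h y (by simp [hy])

theorem exists_of_position_eq_some {m : List (Fin k × A)} {i : Fin k} {a : A}
    (h : position m i = some a) :
    ∃ l l', m = l ++ [(i, a)] ++ l' ∧ ∀ x ∈ l', x.1 ≠ i := by
  induction m using List.reverseRecOn with
  | nil => simp at h
  | append_singleton m x ih =>
    rw [position_append_singleton] at h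
    by_cases hx : i = x.1
    · subst hx
      rw [Function.update_self, Option.some_inj] at h
      exact ⟨m, [], by simp [← h], by simp⟩
    · rw [Function.update_of_ne hx] at h
      obtain ⟨l, l', rfl, hl'⟩ := ih h
      refine ⟨l, l' ++ [x], by simp, fun y hy => ?_⟩
      rcases List.mem_append.1 hy with hy | hy
      · exact hl' y hy
      · rw [List.mem_singleton.1 hy]
        exact Ne.symm hx

end Position

namespace Play

variable {k : ℕ} {A C : Type u}

theorem le_iff {s t : Play k A} : s ≤ t ↔ s.moves <+: t.moves := Iff.rfl

theorem moves_eq (s : Play k A) : s.moves = s.moves.dropLast ++ [(s.pebble, s.elem)] :=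
  (List.dropLast_append_getLast s.nonempty).symm

theorem length_pos (s : Play k A) : 0 < s.moves.length :=
  List.length_pos_of_ne_nil s.nonempty

theorem position_moves (s : Play k A) : position s.moves s.pebble = some s.elem := by
  conv_lhs => rw [moves_eq s]
  rw [position_append_singleton, Function.update_self]

theorem pebble_elem_of_moves_eq {s : Play k A} {m : List (Fin k × A)} {x : Fin k × A}
    (h : s.moves = m ++ [x]) : s.pebble = x.1 ∧ s.elem = x.2 := by
  simp [pebble, elem, h]

theorem length_lt_of_lt {s t : Play k A} (h : s < t) : s.moves.length < t.moves.length := by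
  refine lt_of_le_of_ne (le_iff.1 h.le).length_le fun h' => h.ne ?_
  exact Play.ext ((le_iff.1 h.le).eq_of_length h')

theorem isMin_iff {s : Play k A} : IsMin s ↔ s.moves.length = 1 := by
  refine ⟨fun h => ?_, fun h t ht => ?_⟩
  · have hs := s.length_pos
    let t : Play k A := ⟨s.moves.take 1, by simp [s.nonempty]⟩
    have := le_iff.1 (h (show t ≤ s from List.take_prefix _ _))
    have := this.length_le
    simp only [t, List.length_take] at this
    omega
  · rcases ht.eq_or_lt with rfl | ht
    · exact le_rfl
    · have := length_lt_of_lt ht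
      have := t.length_pos
      omega

theorem covBy_iff {s t : Play k A} :
    s ⋖ t ↔ s ≤ t ∧ t.moves.length = s.moves.length + 1 := by
  refine ⟨fun h => ⟨h.le, ?_⟩, fun h => ⟨?_, fun r hr hrt => ?_⟩⟩
  · by_contra hne
    have hlt := length_lt_of_lt h.lt
    let r : Play k A := ⟨t.moves.take (s.moves.length + 1), by simp [t.nonempty]⟩
    have hr : r.moves.length = s.moves.length + 1 := by
      simp only [r, List.length_take]; omega
    have hrt : r ≤ t := List.take_prefix _ _
    have hsr : s ≤ r := List.prefix_of_prefix_length_le h.le hrt (by omega)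
    refine h.2 (hsr.lt_of_ne fun h' => ?_) (hrt.lt_of_ne fun h' => ?_)
    · rw [← h'] at hr; omega
    · rw [h'] at hr; omega
  · refine h.1.lt_of_ne fun h' => ?_
    have := h.2
    rw [← h'] at this; omega
  · have := length_lt_of_lt hr
    have := length_lt_of_lt hrt
    omega

theorem covBy_iff_exists {s t : Play k A} : s ⋖ t ↔ ∃ x, t.moves = s.moves ++ [x] := by
  rw [covBy_iff]
  constructor
  · rintro ⟨⟨l, hl⟩, h⟩
    rw [← hl, List.length_append, Nat.add_left_cancel_iff, List.length_eq_one_iff] at h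
    obtain ⟨x, rfl⟩ := h
    exact ⟨x, hl.symm⟩
  · rintro ⟨x, hx⟩
    exact ⟨⟨[x], hx.symm⟩, by simp [hx]⟩

/-- The image of a play under a function. -/
def map (π : C → A) (s : Play k C) : Play k A :=
  ⟨s.moves.map (Prod.map id π), by simp [s.nonempty]⟩

@[simp]
theorem moves_map (π : C → A) (s : Play k C) :
    (s.map π).moves = s.moves.map (Prod.map id π) := rfl

@[simp]
theorem pebble_map (π : C → A) (s : Play k C) : (s.map π).pebble = s.pebble := by
  simp [pebble, List.getLast_map]

@[simp]
theorem elem_map (π : C → A) (s : Play k C) : (s.map π).elem = π s.elem := by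
  simp [elem, List.getLast_map]

theorem map_mono (π : C → A) {s t : Play k C} (h : s ≤ t) : s.map π ≤ t.map π :=
  List.IsPrefix.map _ h

/-- A projection preserves length, and comparable plays of equal length coincide. Incomparable plays
may well be identified by `π`. -/
theorem eq_of_map_eq (π : C → A) {s t : Play k C} (h : s ≤ t ∨ t ≤ s)
    (hst : s.map π = t.map π) : s = t := by
  have hl : s.moves.length = t.moves.length := by
    simpa using congrArg (fun r : Play k A => r.moves.length) hst
  rcases h with h | h
  · exact Play.ext ((le_iff.1 h).eq_of_length hl)
  · exact (Play.ext ((le_iff.1 h).eq_of_length hl.symm)).symm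

/-- The pebble of `s` is still where `s` has placed it when `t` has been played. -/
theorem position_of_le {s t : Play k A} (h : s ≤ t)
    (hl : ∀ l, t.moves = s.moves ++ l → ∀ x ∈ l, x.1 ≠ s.pebble) :
    position t.moves s.pebble = some s.elem := by
  obtain ⟨l, hl'⟩ := h
  rw [← hl', position_append_of_forall_ne _ (hl l hl'.symm), position_moves]

end Play

/-! ### Projections that are open pathwise embeddings -/

section Projection

variable {L : FirstOrder.Language.{w, v}} [L.IsRelational] {k : ℕ} {A C : Type u}
  [L.Structure A] [L.Structure C]

theorem Play.relMap_map (π : C →[L] A) {n : ℕ} (R : L.Relations n) (s : Fin n → Play k C)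
    (h : RelMap R s) : RelMap R fun i => (s i).map π := by
  obtain ⟨hs, hl, hR⟩ := h
  refine ⟨fun i j => (hs i j).imp (Play.map_mono π) (Play.map_mono π), ?_, ?_⟩
  · rintro i j l h x hx
    simp only [Play.moves_map, Play.pebble_map] at h ⊢
    rcases hs i j with ⟨l', hl'⟩ | ⟨l', hl'⟩
    · rw [← hl', List.map_append, List.append_cancel_left_eq] at h
      subst h
      obtain ⟨y, hy, rfl⟩ := List.mem_map.1 hx
      exact hl i j l' hl'.symm y hy
    · have := congrArg List.length h
      simp only [← hl', List.length_map, List.length_append] at this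
      have : l = [] := List.eq_nil_of_length_eq_zero (by omega)
      simp [this] at hx
  · simpa [Function.comp_def] using π.map_rel R _ hR

/-- The pebbling comonad on homomorphisms. -/
def cofreeMap (k : ℕ) (π : C →[L] A) : cofree L k C ⟶ cofree L k A where
  toHom :=
    { toFun := Play.map π
      map_fun' := fun f => isEmptyElim f
      map_rel' := fun R s hR => Play.relMap_map π R s hR }
  map_root s h := Play.isMin_iff.2 ((List.length_map _).trans (Play.isMin_iff.1 h))
  map_covBy s t h := by
    obtain ⟨x, hx⟩ := Play.covBy_iff_exists.1 h
    exact Play.covBy_iff_exists.2 ⟨Prod.map id π x,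
      (congrArg (List.map (Prod.map id π)) hx).trans List.map_append⟩
  map_pebble s := Play.pebble_map π s

/-- A set of lists of moves on `C`, closed under prefixes, in which all moves on `A` can be
lifted along `π : C → A`, and such that `π` reflects the relations between the elements of any
position. -/
structure IsLiftingSystem (π : C →[L] A) (G : Set (List (Fin k × C))) : Prop where
  nil_mem : [] ∈ G
  mem_of_append : ∀ l l', l ++ l' ∈ G → l ∈ G
  exists_lift : ∀ l ∈ G, ∀ r a, ∃ c, π c = a ∧ l ++ [(r, c)] ∈ G
  reflect : ∀ l ∈ G, ∀ (n : ℕ) (R : L.Relations n) (i : Fin n → Fin k) (c : Fin n → C),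
    (∀ j, position l (i j) = some (c j)) → RelMap R (fun j => π (c j)) → RelMap R c

/-- The plays whose list of moves lies in a prefix-closed set. -/
def lowerSetOfPrefix (G : Set (List (Fin k × C))) (hG : ∀ l l', l ++ l' ∈ G → l ∈ G) :
    LowerSet (Play k C) where
  carrier := {s | s.moves ∈ G}
  lower' := by
    rintro s t ⟨l, hl⟩ hs
    rw [Set.mem_ofPred_eq, ← hl] at hs
    exact hG _ _ hs

namespace IsLiftingSystem

variable {π : C →[L] A} {G : Set (List (Fin k × C))}

/-- Relatedness of the images forces every pebble involved to be still in place when the longest of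
the plays ends. All the elements thus belong to one position, where `reflect` applies. -/
theorem relMap_of_map (h : IsLiftingSystem π G) {n : ℕ} (R : L.Relations n)
    (s : Fin n → Play k C) (hs : ∀ i j, s i ≤ s j ∨ s j ≤ s i) (hG : ∀ i, (s i).moves ∈ G)
    (hR : RelMap R fun i => (s i).map π) : RelMap R s := by
  have hlive : ∀ i j, ∀ l : List (Fin k × C), (s j).moves = (s i).moves ++ l →
      ∀ x ∈ l, x.1 ≠ (s i).pebble := by
    intro i j l hl x hx
    have := hR.2.1 i j (l.map (Prod.map id π)) (by simp [hl]) _ (List.mem_map_of_mem hx)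
    simpa using this
  refine ⟨hs, hlive, ?_⟩
  -- For `n = 0` there is no longest play and the empty list serves.
  obtain ⟨l, hl, hpos⟩ : ∃ l ∈ G, ∀ j, position l (s j).pebble = some (s j).elem := by
    rcases isEmpty_or_nonempty (Fin n) with hn | hn
    · exact ⟨[], h.nil_mem, fun j => isEmptyElim j⟩
    · obtain ⟨t, ht⟩ := Finite.exists_max fun j => (s j).moves.length
      refine ⟨(s t).moves, hG t, fun j => Play.position_of_le ?_ (hlive j t)⟩
      rcases hs j t with hj | hj
      · exact hj
      · exact (Play.ext ((Play.le_iff.1 hj).eq_of_length (le_antisymm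
          (Play.le_iff.1 hj).length_le (ht j)))).symm.le
  refine h.reflect l hl n R _ _ hpos ?_
  simpa using hR.2.2

/-- The object of plays in a lifting system. -/
abbrev forest (h : IsLiftingSystem π G) : PebbleForest.{u} L k :=
  (cofree L k C).sub (lowerSetOfPrefix G h.mem_of_append)

/-- The projection to the plays on the target. -/
abbrev proj (h : IsLiftingSystem π G) : h.forest ⟶ cofree L k A :=
  PebbleForest.incl _ _ ≫ cofreeMap k π

theorem relMap_of_proj (h : IsLiftingSystem π G) {n : ℕ} (R : L.Relations n)
    (x : Fin n → h.forest) (hx : ∀ i j, x i ≤ x j ∨ x j ≤ x i)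
    (hR : RelMap R fun i => h.proj.toHom (x i)) : RelMap R x :=
  h.relMap_of_map R (fun i => (x i).1) hx (fun i => (x i).2) hR

/-- The lift of a list of moves on `A` (in reverse order), given the lifts of some lists. -/
noncomputable def liftMoves (h : IsLiftingSystem π G) (F : Set h.forest) :
    List (Fin k × A) → G
  | [] => ⟨[], h.nil_mem⟩
  | x :: l => by
    classical
    -- Lists that already have a lift in `F` keep it, so that the filler agrees with the given path;
    -- any other list prolongs the lift of its initial part by one chosen answer.
    exact if hx : ∃ z ∈ F, (h.proj.toHom z).moves.reverse = x :: l then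
      ⟨(hx.choose.1 : Play k C).moves, hx.choose.2⟩
    else
      ⟨(liftMoves h F l).1 ++ [(x.1, (h.exists_lift _ (liftMoves h F l).2 x.1 x.2).choose)],
        (h.exists_lift _ (liftMoves h F l).2 x.1 x.2).choose_spec.2⟩

theorem map_liftMoves (h : IsLiftingSystem π G) (F : Set h.forest) (l : List (Fin k × A)) :
    (h.liftMoves F l).1.map (Prod.map id π) = l.reverse := by
  induction l with
  | nil => simp [liftMoves]
  | cons x l ih =>
    rw [liftMoves]
    split_ifs with hx
    · have := congrArg List.reverse hx.choose_spec.2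
      rw [List.reverse_reverse] at this
      exact this
    · have := (h.exists_lift _ (h.liftMoves F l).2 x.1 x.2).choose_spec.1
      simp [ih, this]

theorem liftMoves_cons_of_not (h : IsLiftingSystem π G) {F : Set h.forest} {x : Fin k × A}
    {l : List (Fin k × A)} (hx : ¬ ∃ z ∈ F, (h.proj.toHom z).moves.reverse = x :: l) :
    ∃ y, (h.liftMoves F (x :: l)).1 = (h.liftMoves F l).1 ++ [y] := by
  rw [liftMoves, dif_neg hx]
  exact ⟨_, rfl⟩

/-- Injectivity of the projection on `F` leaves only one element to choose. -/
theorem liftMoves_of_mem (h : IsLiftingSystem π G) {F : Set h.forest}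
    (hF : ∀ y ∈ F, ∀ z ∈ F, h.proj.toHom y = h.proj.toHom z → y = z) {z : h.forest}
    (hz : z ∈ F) :
    (h.liftMoves F (h.proj.toHom z).moves.reverse).1 = (z.1 : Play k C).moves := by
  obtain ⟨x, l, hl⟩ := List.exists_cons_of_ne_nil
    (List.reverse_ne_nil_iff.2 (h.proj.toHom z).nonempty)
  have hx : ∃ z ∈ F, (h.proj.toHom z).moves.reverse = x :: l := ⟨z, hz, hl⟩
  rw [hl, liftMoves, dif_pos hx]
  have : hx.choose = z := by
    refine hF _ hx.choose_spec.1 _ hz (Play.ext (List.reverse_injective ?_))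
    rw [hx.choose_spec.2, hl]
  exact congrArg (fun y : h.forest => (y.1 : Play k C).moves) this

end IsLiftingSystem

end Projection

/-! ### Lifting systems give open pathwise embeddings -/

namespace IsLiftingSystem

variable {L : FirstOrder.Language.{w, v}} [L.IsRelational] {k : ℕ} {A C : Type u}
  [(plus L).Structure A] [(plus L).Structure C] {π : C →[plus L] A}
  {G : Set (List (Fin k × C))}

theorem isPathwiseEmbedding_proj (h : IsLiftingSystem π G) : IsPathwiseEmbedding h.proj := by
  intro P e hP he
  have hc : ∀ x y : P, e.toHom x ≤ e.toHom y ∨ e.toHom y ≤ e.toHom x := fun x y =>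
    (hP.1 x y).imp (PebbleForest.hom_mono e) (PebbleForest.hom_mono e)
  refine ⟨fun x y hxy => he.1 (Subtype.ext (Play.eq_of_map_eq π (hc x y) hxy)),
    fun n R x hR => he.2 n R x (h.relMap_of_proj R _ (fun i j => hc _ _) hR)⟩

/-- The filler lifts the branch `Q` move by move, keeping the lifts prescribed on `P`. It preserves
relations because the projection reflects them on chains, and it is an embedding because its
composite with the projection is `e'`. -/
theorem isOpenMorphism_proj (h : IsLiftingSystem π G) : IsOpenMorphism h.proj := by
  intro P Q i e e' hP hQ hi he he' hsq
  have hsq' : ∀ z : P, h.proj.toHom (e.toHom z) = e'.toHom (i.toHom z) := fun z =>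
    congrArg (fun f => f.toHom z) hsq
  set F : Set h.forest := Set.range e.toHom
  have hF : ∀ y ∈ F, ∀ z ∈ F, h.proj.toHom y = h.proj.toHom z → y = z := by
    rintro _ ⟨y, rfl⟩ _ ⟨z, rfl⟩ hyz
    rw [hsq', hsq'] at hyz
    rw [hi.1 (he'.1 hyz)]
  let mv : Q → List (Fin k × A) := fun x => Play.moves (e'.toHom x)
  have hmv : ∀ x, mv x ≠ [] := fun x => Play.nonempty (e'.toHom x)
  have hlift : ∀ x, (h.liftMoves F (mv x).reverse).1.map (Prod.map id π) = mv x := fun x => by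
    rw [map_liftMoves, List.reverse_reverse]
  let d : Q → Play k C := fun x => ⟨(h.liftMoves F (mv x).reverse).1, fun hnil => by
    have := hlift x
    rw [hnil] at this
    exact hmv x this.symm⟩
  have hdmap : ∀ x, (d x).map π = e'.toHom x := fun x => Play.ext (hlift x)
  have hdlen : ∀ x, (d x).moves.length = (mv x).length := fun x => by
    conv_rhs => rw [← hlift x, List.length_map]
  have hdi : ∀ z : P, d (i.toHom z) = (e.toHom z).1 := fun z => by
    refine Play.ext ?_
    have := h.liftMoves_of_mem hF ⟨z, rfl⟩
    rw [hsq'] at this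
    exact this
  have hdcov : ∀ x y, x ⋖ y → d x ⋖ d y := by
    intro x y hxy
    have hc := Play.covBy_iff.1 (e'.map_covBy x y hxy)
    obtain ⟨a, ha⟩ := Play.covBy_iff_exists.1 (e'.map_covBy x y hxy)
    refine Play.covBy_iff.2 ⟨?_, by rw [hdlen, hdlen]; exact hc.2⟩
    -- The image of `i` is downward closed. If `y` lies in it, so does `x`, and both lifts come from
    -- `e`; otherwise the lift of `y` prolongs that of `x` by construction.
    by_cases hy : ∃ z, i.toHom z = y
    · obtain ⟨z, rfl⟩ := hy
      obtain ⟨z', hz', rfl⟩ := PebbleForest.exists_le_map_eq i hxy.le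
      rw [hdi, hdi]
      exact PebbleForest.hom_mono e hz'
    · have hrev : (mv y).reverse = a :: (mv x).reverse := by
        simp only [mv, ha, List.reverse_append, List.reverse_singleton, List.singleton_append]
      obtain ⟨b, hb⟩ := h.liftMoves_cons_of_not (F := F) (x := a) (l := (mv x).reverse) (by
        rintro ⟨_, ⟨z, rfl⟩, hz⟩
        rw [← hrev, hsq'] at hz
        exact hy ⟨z, he'.1 (Play.ext (List.reverse_injective hz))⟩)
      refine ⟨[b], ?_⟩
      change _ = (h.liftMoves F (mv y).reverse).1
      rw [hrev, hb]
  let D : Q → h.forest := fun x => ⟨d x, (h.liftMoves F (mv x).reverse).2⟩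
  have hDcov : ∀ x y, x ⋖ y → D x ⋖ D y := fun x y hxy =>
    PebbleForest.covBy_sub.2 (hdcov x y hxy)
  have hDmono : Monotone D := by
    let := Q.locallyFiniteOrder
    intro x y hxy
    induction le_iff_reflTransGen_covBy.1 hxy with
    | refl => exact le_rfl
    | tail hb hbc ih =>
      exact (ih (le_iff_reflTransGen_covBy.2 hb)).trans (hDcov _ _ hbc).le
  have hDmap : ∀ x, h.proj.toHom (D x) = e'.toHom x := hdmap
  let f : Q ⟶ h.forest :=
    { toHom :=
        { toFun := D
          map_fun' := fun f => isEmptyElim f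
          map_rel' := fun R x hR => by
            refine h.relMap_of_proj R _ (fun i j => (hQ.1 (x i) (x j)).imp (@hDmono _ _)
              (@hDmono _ _)) ?_
            simp only [Function.comp_apply, hDmap]
            exact e'.toHom.map_rel R x hR }
      map_root := fun x hx => PebbleForest.isMin_sub.2 (Play.isMin_iff.2 (by
        exact (hdlen x).trans (Play.isMin_iff.1 (e'.map_root x hx))))
      map_covBy := hDcov
      map_pebble := fun x => by
        rw [← e'.map_pebble x, ← hDmap, h.proj.map_pebble]
        rfl }
  have hf : f ≫ h.proj = e' := by
    refine PebbleForest.Hom.ext (FirstOrder.Language.Hom.ext fun x => hDmap x)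
  refine ⟨f, PebbleForest.IsEmbedding.of_comp (g := h.proj) (hf ▸ he'), ?_, hf⟩
  exact PebbleForest.Hom.ext (FirstOrder.Language.Hom.ext fun z => Subtype.ext (hdi z))

end IsLiftingSystem

/-! ### Assignments -/

section Assign

variable {k : ℕ} {A B : Type*} {S : Set (Fin k)}

theorem assign_of_eq (v : S → A) {i : Fin k} (a : A) {j : ↥(insert i S : Set (Fin k))}
    (h : (j : Fin k) = i) : assign v i a j = a := dif_pos h

theorem assign_of_ne (v : S → A) {i : Fin k} (a : A) {j : ↥(insert i S : Set (Fin k))}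
    (h : (j : Fin k) ≠ i) :
    assign v i a j = v ⟨j, (Set.mem_insert_iff.mp j.2).resolve_left h⟩ := dif_neg h

theorem comp_assign (f : A → B) (v : S → A) (i : Fin k) (a : A) :
    (fun j => f (assign v i a j)) = assign (fun j => f (v j)) i (f a) := by
  funext j
  by_cases h : (j : Fin k) = i
  · rw [assign_of_eq _ _ h, assign_of_eq _ _ h]
  · rw [assign_of_ne _ _ h, assign_of_ne _ _ h]

end Assign

/-! ### From equivalence to a span -/

section Types

variable {L : FirstOrder.Language.{w, v}} {k : ℕ} {A B : Type u} [L.Structure A] [L.Structure B]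

/-- Assignments that satisfy the same formulas can be extended in such a way that they still do. -/
theorem exists_assign_realize_iff {S : Set (Fin k)} {v : S → A} {w : S → B}
    (h : ∀ φ : KFormula.{u} L k S, φ.Realize A v ↔ φ.Realize B w) (r : Fin k) (a : A) :
    ∃ b : B, ∀ φ : KFormula.{u} L k (insert r S),
      φ.Realize A (assign v r a) ↔ φ.Realize B (assign w r b) := by
  by_contra! hne
  have key : ∀ b : B, ∃ φ : KFormula.{u} L k (insert r S),
      φ.Realize A (assign v r a) ∧ ¬ φ.Realize B (assign w r b) := by
    intro b
    obtain ⟨φ, ⟨h₁, h₂⟩ | ⟨h₁, h₂⟩⟩ := hne b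
    · exact ⟨φ, h₁, h₂⟩
    · exact ⟨.neg φ, h₁, fun h => h h₂⟩
  choose φ hφ using key
  -- The conjunction is indexed by `B` itself, which lies in the universe of the admitted index
  -- types.
  obtain ⟨b, hb⟩ := (h (.ex r (.conj φ))).1 ⟨a, fun b => (hφ b).1⟩
  exact (hφ b).2 (hb b)

variable (L) in
/-- The positions on `A` and on `B` reached by a list of moves on `A × B` satisfy the same
formulas. -/
def SameType (m : List (Fin k × (A × B))) : Prop :=
  ∀ (S : Set (Fin k)) (φ : KFormula.{u} L k S) (v : S → A × B),
    (∀ i, i ∈ S ↔ (position m i).isSome) → (∀ i : S, position m i = some (v i)) →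
    (φ.Realize A (fun i => (v i).1) ↔ φ.Realize B fun i => (v i).2)

theorem sameType_nil (h : KEquivalent L k A B) :
    SameType L ([] : List (Fin k × (A × B))) := by
  intro S φ v hS _
  obtain rfl : S = ∅ := Set.eq_empty_of_forall_notMem fun i hi => by simpa using (hS i).1 hi
  have hA : (fun i => (v i).1) = fun i : (∅ : Set (Fin k)) => (False.elim i.2 : A) :=
    funext fun i => i.2.elim
  have hB : (fun i => (v i).2) = fun i : (∅ : Set (Fin k)) => (False.elim i.2 : B) :=
    funext fun i => i.2.elim
  rw [hA, hB]
  exact h φ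

namespace SameType

variable {m : List (Fin k × (A × B))}

theorem realize_get (h : SameType L m)
    (φ : KFormula.{u} L k {i | (position m i).isSome}) :
    φ.Realize A (fun i => ((position m i).get i.2).1) ↔
      φ.Realize B fun i => ((position m i).get i.2).2 :=
  h _ φ _ (fun _ => Iff.rfl) fun i => (Option.some_get i.2).symm

/-- The new position is defined on the old domain with `r` inserted, and its values are those of
`assign`; placing a pebble is reassigning a variable. -/
theorem append_singleton {r : Fin k} {a : A} {b : B}
    (h : ∀ φ : KFormula.{u} L k (insert r {i | (position m i).isSome}),
      φ.Realize A (assign (fun i => ((position m i).get i.2).1) r a) ↔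
        φ.Realize B (assign (fun i => ((position m i).get i.2).2) r b)) :
    SameType L (m ++ [(r, (a, b))]) := by
  intro S φ v hS hv
  rw [position_append_singleton] at hS hv
  obtain rfl : S = insert r {i | (position m i).isSome} := by
    ext i
    rw [hS]
    by_cases hi : i = r
    · subst hi; simp
    · simp [hi]
  obtain rfl : v = assign (fun i : {i | (position m i).isSome} => (position m i).get i.2) r
      (a, b) := by
    funext j
    have := hv j
    by_cases hj : (j : Fin k) = r
    · rw [assign_of_eq _ _ hj]
      simpa [hj, eq_comm] using this
    · rw [assign_of_ne _ _ hj]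
      rw [Function.update_of_ne hj] at this
      simp [this]
  rw [comp_assign Prod.fst, comp_assign Prod.snd]
  exact h φ

theorem exists_fst (h : SameType L m) (r : Fin k) (a : A) :
    ∃ b : B, SameType L (m ++ [(r, (a, b))]) := by
  obtain ⟨b, hb⟩ := exists_assign_realize_iff h.realize_get r a
  exact ⟨b, append_singleton hb⟩

theorem exists_snd (h : SameType L m) (r : Fin k) (b : B) :
    ∃ a : A, SameType L (m ++ [(r, (a, b))]) := by
  obtain ⟨a, ha⟩ := exists_assign_realize_iff (fun φ => (h.realize_get φ).symm) r b
  exact ⟨a, append_singleton fun φ => (ha φ).symm⟩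

/-- Only atomic formulas are needed; the symbol `I` is matched by equality. -/
theorem relMap_iff (h : SameType L m) {n : ℕ} (R : (plus L).Relations n) (i : Fin n → Fin k)
    (c : Fin n → A × B) (hc : ∀ j, position m (i j) = some (c j)) :
    (expandI L A).RelMap R (fun j => (c j).1) ↔ (expandI L B).RelMap R fun j => (c j).2 := by
  have hi : ∀ j, i j ∈ {i | (position m i).isSome} := fun j => by simp [hc j]
  have hget : ∀ j, (position m (i j)).get (hi j) = c j := fun j => by simp [hc j]
  match n, R with
  | _, .inl R =>
    have := h.realize_get (.rel R fun j => ⟨i j, hi j⟩)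
    simp only [KFormula.Realize, hget] at this
    exact this
  | _, .inr IdSymbol.I =>
    have := h.realize_get (.equal ⟨i 0, hi 0⟩ ⟨i 1, hi 1⟩)
    simp only [KFormula.Realize, hget] at this
    exact this

end SameType

end Types

/-! ### The product structure and the span of plays of the same type -/

section Product

variable (L : FirstOrder.Language.{w, v}) [L.IsRelational] (A B : Type u)
  [L.Structure A] [L.Structure B]

/-- The product of two relational structures. -/
@[reducible]
def prodStructure : L.Structure (A × B) where
  funMap f := isEmptyElim f
  RelMap R c := RelMap R (fun j => (c j).1) ∧ RelMap R fun j => (c j).2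

attribute [local instance] prodStructure

/-- The first projection. -/
def fstHom : A × B →[L] A where
  toFun := Prod.fst
  map_fun' f := isEmptyElim f
  map_rel' _ _ h := h.1

/-- The second projection. -/
def sndHom : A × B →[L] B where
  toFun := Prod.snd
  map_fun' f := isEmptyElim f
  map_rel' _ _ h := h.2

end Product

theorem KEquivalent.backAndForth {L : FirstOrder.Language.{w, v}} [L.IsRelational] {k : ℕ}
    {A B : Type u} [L.Structure A] [L.Structure B] (h : KEquivalent L k A B) :
    BackAndForth L k A B := by
  let := expandI L A
  let := expandI L B
  let := prodStructure (plus L) A B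
  -- Agreement is demanded of all prefixes because a later position may have forgotten a difference
  -- between earlier ones.
  let G : Set (List (Fin k × (A × B))) := {m | ∀ m', m' <+: m → SameType L m'}
  have hnil : [] ∈ G := fun m' hm' => by
    rw [List.prefix_nil.1 hm']
    exact sameType_nil h
  have happ : ∀ l l', l ++ l' ∈ G → l ∈ G := fun l l' hl m' hm' =>
    hl m' (hm'.trans (List.prefix_append l l'))
  have hsnoc : ∀ l ∈ G, ∀ x, SameType L (l ++ [x]) → l ++ [x] ∈ G := by
    intro l hl x hx m' hm'
    rcases List.prefix_concat_iff.1 hm' with rfl | hm'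
    · exact hx
    · exact hl m' hm'
  have hA : IsLiftingSystem (fstHom (plus L) A B) G :=
    { nil_mem := hnil
      mem_of_append := happ
      exists_lift := fun l hl r a => by
        obtain ⟨b, hb⟩ := (hl l List.prefix_rfl).exists_fst r a
        exact ⟨(a, b), rfl, hsnoc l hl _ hb⟩
      reflect := fun l hl n R i c hc hR =>
        ⟨hR, ((hl l List.prefix_rfl).relMap_iff R i c hc).1 hR⟩ }
  have hB : IsLiftingSystem (sndHom (plus L) A B) G :=
    { nil_mem := hnil
      mem_of_append := happ
      exists_lift := fun l hl r b => by
        obtain ⟨a, ha⟩ := (hl l List.prefix_rfl).exists_snd r b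
        exact ⟨(a, b), rfl, hsnoc l hl _ ha⟩
      reflect := fun l hl n R i c hc hR =>
        ⟨((hl l List.prefix_rfl).relMap_iff R i c hc).2 hR, hR⟩ }
  exact ⟨hA.forest, hA.proj, hB.proj, hA.isOpenMorphism_proj, hA.isPathwiseEmbedding_proj,
    hB.isOpenMorphism_proj, hB.isPathwiseEmbedding_proj⟩

/-! ### From a span to equivalence -/

namespace PebbleForest

/-- The pebble of `x` is not moved after `x`. -/
def IsLive {L : FirstOrder.Language.{w, v}} {k : ℕ} {P : PebbleForest.{u} L k} (x : P) : Prop :=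
  ∀ y, x < y → P.pebble y ≠ P.pebble x

variable {L : FirstOrder.Language.{w, v}} [L.IsRelational] {k : ℕ} {A : Type u} [L.Structure A]
  {P : PebbleForest.{u} L k}

/-- The play of which an element of a forest over the plays on `A` consists. -/
def play (f : P ⟶ cofree L k A) (x : P) : Play k A := f.toHom x

variable {f : P ⟶ cofree L k A}

theorem pebble_play (x : P) : (play f x).pebble = P.pebble x := f.map_pebble x

theorem play_mono {x y : P} (h : x ≤ y) : play f x ≤ play f y := hom_mono f h

theorem play_strictMono {x y : P} (h : x < y) : play f x < play f y := hom_strictMono f h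

theorem exists_play_eq {s : Play k A} {x : P} (h : s ≤ play f x) : ∃ y ≤ x, play f y = s :=
  exists_le_map_eq f h

/-- A later move of the same pebble would end a prefix of the play at `z`. That prefix lifts to an
element above `x` carrying the pebble of `x`, against liveness. -/
theorem IsLive.ne_of_mem (hP : ∀ x y : P, x ≤ y ∨ y ≤ x) {x z : P} (hx : IsLive x)
    {l : List (Fin k × A)} (hl : (play f z).moves = (play f x).moves ++ l) {c : Fin k × A}
    (hc : c ∈ l) : c.1 ≠ P.pebble x := by
  obtain ⟨l₁, l₂, rfl⟩ := List.append_of_mem hc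
  obtain ⟨y, -, hy⟩ := exists_play_eq (f := f) (x := z)
    (s := ⟨(play f x).moves ++ l₁ ++ [c], by simp⟩) ⟨l₂, by simp [hl]⟩
  have hlen : (play f x).moves.length < (play f y).moves.length := by
    simp only [hy, List.length_append, List.length_singleton]; omega
  have hxy : x < y := by
    rcases hP x y with h | h
    · exact h.lt_of_ne fun h' => hlen.ne (by rw [h'])
    · exact absurd (Play.le_iff.1 (play_mono (f := f) h)).length_le hlen.not_ge
  have := hx y hxy
  rw [← pebble_play (f := f) y, hy] at this
  rwa [(Play.pebble_elem_of_moves_eq (m := (play f x).moves ++ l₁) (x := c) rfl).1] at this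

theorem IsLive.position_eq (hP : ∀ x y : P, x ≤ y ∨ y ≤ x) {x z : P} (hx : IsLive x)
    (hxz : x ≤ z) : position (play f z).moves (P.pebble x) = some (play f x).elem := by
  rw [← pebble_play (f := f)]
  refine Play.position_of_le (play_mono hxz) fun l hl c hc => ?_
  rw [pebble_play]
  exact hx.ne_of_mem hP hl hc

/-- The last move of pebble `i` ends a prefix, which lifts to some `x`. Every element above `x` ends
with a move of the remaining segment, where `i` is not used. -/
theorem exists_isLive {z : P} (hz : ∀ y, y ≤ z) {i : Fin k} {a : A}
    (h : position (play f z).moves i = some a) :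
    ∃ x, IsLive x ∧ P.pebble x = i ∧ (play f x).elem = a := by
  obtain ⟨l, l', hl, hl'⟩ := exists_of_position_eq_some h
  obtain ⟨x, -, hx⟩ := exists_play_eq (f := f) (x := z) (s := ⟨l ++ [(i, a)], by simp⟩)
    ⟨l', hl.symm⟩
  have hpe := Play.pebble_elem_of_moves_eq (s := play f x) (m := l) (x := (i, a)) (by rw [hx])
  rw [pebble_play] at hpe
  refine ⟨x, fun y hxy => ?_, hpe.1, hpe.2⟩
  rw [hpe.1]
  obtain ⟨l₁, hl₁⟩ := play_mono (f := f) hxy.le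
  obtain ⟨l₂, hl₂⟩ := play_mono (f := f) (hz y)
  have hne : l₁ ≠ [] := by
    rintro rfl
    exact (play_strictMono (f := f) hxy).ne (Play.ext (by simpa using hl₁))
  obtain ⟨l₃, c, rfl⟩ : ∃ l₃ c, l₁ = l₃ ++ [c] :=
    ⟨_, _, (List.dropLast_append_getLast hne).symm⟩
  rw [← List.append_assoc] at hl₁
  rw [← pebble_play (f := f) y, (Play.pebble_elem_of_moves_eq hl₁.symm).1]
  refine hl' c ?_
  rw [← hl₁, hl, hx, List.append_assoc, List.append_assoc, List.append_cancel_left_eq] at hl₂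
  simp [← hl₂]

/-- For live elements of a path, the comparability and pebble conditions in the relations on plays
hold automatically, leaving only the relation in `A`. -/
theorem relMap_iff_of_isLive (hP : ∀ x y : P, x ≤ y ∨ y ≤ x) (hf : IsEmbedding f) {n : ℕ}
    (R : L.Relations n) (x : Fin n → P) (hx : ∀ j, IsLive (x j)) :
    RelMap R x ↔ RelMap R fun j => (play f (x j)).elem := by
  refine ⟨fun h => (f.toHom.map_rel R x h).2.2, fun h => hf.2 n R x ⟨fun i j =>
    (hP (x i) (x j)).imp play_mono play_mono, fun i j l hl c hc => ?_, h⟩⟩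
  exact fun h' => (hx i).ne_of_mem hP hl hc (h'.trans (pebble_play (x i)))

end PebbleForest

open PebbleForest

/-! ### Pairs of positions lying under a common path of the span -/

section Reaches

variable {L : FirstOrder.Language.{w, v}} [L.IsRelational] {k : ℕ} {A B : Type u}
  [(plus L).Structure A] [(plus L).Structure B] {R : PebbleForest.{u} (plus L) k}
  {p : R ⟶ cofree (plus L) k A} {q : R ⟶ cofree (plus L) k B}
  {m : List (Fin k × A)} {m' : List (Fin k × B)}

/-- Some path in `R` lies over the moves `m` on `A` and `m'` on `B`. -/
def Reaches (p : R ⟶ cofree (plus L) k A) (q : R ⟶ cofree (plus L) k B)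
    (m : List (Fin k × A)) (m' : List (Fin k × B)) : Prop :=
  ∃ (P : PebbleForest.{u} (plus L) k) (e : P ⟶ R), IsPath P ∧ IsEmbedding e ∧
    ((IsEmpty P ∧ m = [] ∧ m' = []) ∨
      ∃ z : P, (∀ y, y ≤ z) ∧ (play (e ≫ p) z).moves = m ∧ (play (e ≫ q) z).moves = m')

theorem reaches_nil (p : R ⟶ cofree (plus L) k A) (q : R ⟶ cofree (plus L) k B) :
    Reaches p q [] [] :=
  ⟨R.sub ⊥, R.incl ⊥, ⟨fun x => x.2.elim, fun x => x.2.elim⟩, isEmbedding_incl,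
    .inl ⟨⟨fun x => x.2⟩, rfl, rfl⟩⟩

namespace Reaches

theorem symm (h : Reaches p q m m') : Reaches q p m' m := by
  obtain ⟨P, e, hP, he, ⟨h₁, h₂, h₃⟩ | ⟨z, h₁, h₂, h₃⟩⟩ := h
  · exact ⟨P, e, hP, he, .inl ⟨h₁, h₃, h₂⟩⟩
  · exact ⟨P, e, hP, he, .inr ⟨z, h₁, h₃, h₂⟩⟩

theorem exists_position (h : Reaches p q m m') {i : Fin k} {a : A}
    (hi : position m i = some a) : ∃ b, position m' i = some b := by
  obtain ⟨P, e, hP, he, ⟨-, rfl, -⟩ | ⟨z, hz, rfl, rfl⟩⟩ := h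
  · simp at hi
  · obtain ⟨x, hx, rfl, -⟩ := exists_isLive hz hi
    exact ⟨_, hx.position_eq hP.1 (hz x)⟩

/-- Both positions are read off the same live elements of `P`, so the relation in `P` mediates
between `A` and `B`. -/
theorem relMap_iff (h : Reaches p q m m') (hp : IsPathwiseEmbedding p)
    (hq : IsPathwiseEmbedding q) {n : ℕ} (S : (plus L).Relations n) {i : Fin n → Fin k}
    {a : Fin n → A} {b : Fin n → B} (ha : ∀ j, position m (i j) = some (a j))
    (hb : ∀ j, position m' (i j) = some (b j)) : RelMap S a ↔ RelMap S b := by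
  obtain ⟨P, e, hP, he, hz⟩ := h
  have key : ∀ j, ∃ x : P, IsLive x ∧ (play (e ≫ p) x).elem = a j ∧
      (play (e ≫ q) x).elem = b j := by
    intro j
    obtain ⟨-, rfl, -⟩ | ⟨z, hz, rfl, rfl⟩ := hz
    · simpa using ha j
    · obtain ⟨x, hx, hxi, hxa⟩ := exists_isLive hz (ha j)
      refine ⟨x, hx, hxa, ?_⟩
      have := hx.position_eq (f := e ≫ q) hP.1 (hz x)
      rw [hxi, hb j] at this
      exact (Option.some_inj.1 this).symm
  choose x hx hxa hxb using key
  have h₁ := relMap_iff_of_isLive hP.1 (hp P e hP he) S x hx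
  have h₂ := relMap_iff_of_isLive hP.1 (hq P e hP he) S x hx
  simp only [hxa] at h₁
  simp only [hxb] at h₂
  exact h₁.symm.trans h₂

/-- If a pebble is placed on an element of `A` on which there is none, then there is an answer
in `B`. -/
theorem exists_append_singleton (h : Reaches p q m m')
    (hI : ∀ x y : A, RelMap (symI L) ![x, y] ↔ x = y) (hp : IsPathwiseEmbedding p)
    (hp' : IsOpenMorphism p) (r : Fin k) {a : A} (ha : ∀ i, position m i ≠ some a) :
    ∃ b, Reaches p q (m ++ [(r, a)]) (m' ++ [(r, b)]) := by
  obtain ⟨P, e, hP, he, hz⟩ := h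
  let t : Play k A := ⟨m ++ [(r, a)], by simp⟩
  have htr : t.pebble = r := (Play.pebble_elem_of_moves_eq (s := t) rfl).1
  have hta : t.elem = a := (Play.pebble_elem_of_moves_eq (s := t) rfl).2
  have hPm : ∀ y : P, (play (e ≫ p) y).moves <+: m := by
    obtain ⟨hP', -, -⟩ | ⟨z, hz, rfl, -⟩ := hz
    · exact fun y => isEmptyElim y
    · exact fun y => play_mono (hz y)
  have hmP : ∀ s : Play k A, s.moves <+: m → ∃ y : P, play (e ≫ p) y = s := by
    obtain ⟨-, rfl, -⟩ | ⟨z, hz, rfl, -⟩ := hz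
    · exact fun s hs => absurd (List.prefix_nil.1 hs) s.nonempty
    · exact fun s hs => (exists_play_eq hs).imp fun _ h => h.2
  let T : LowerSet (cofree (plus L) k A) := LowerSet.Iic t
  -- `Q` is the branch of non-empty prefixes of the prolonged play `t`; it consists of the image of
  -- `P` and the new top element.
  let Q := (cofree (plus L) k A).sub T
  have hPT : ∀ y : P, (e ≫ p).toHom y ∈ T := fun y =>
    (hPm y).trans (List.prefix_append _ _)
  let i : P ⟶ Q := lift T (e ≫ p) hPT
  have hi : IsEmbedding i := IsEmbedding.of_comp (g := incl _ T) (hp P e hP he)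
  let top : Q := ⟨t, LowerSet.mem_Iic_iff.2 le_rfl⟩
  have hQ' : ∀ x : Q, x = top ∨ ∃ y, i.toHom y = x := by
    intro x
    rcases List.prefix_concat_iff.1 (show Play.moves x.1 <+: m ++ [(r, a)] from x.2) with hx | hx
    · exact .inl (Subtype.ext (Play.ext hx))
    · obtain ⟨y, hy⟩ := hmP x.1 hx
      exact .inr ⟨y, Subtype.ext hy⟩
  -- A pebble that stands on `a` and survives the move `(r, a)` would already stand on `a` in `m`.
  -- This is where freshness of `a` enters.
  have hfresh : ∀ y : P, (∀ l, t.moves = (play (e ≫ p) y).moves ++ l → ∀ c ∈ l,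
      c.1 ≠ (play (e ≫ p) y).pebble) → (play (e ≫ p) y).elem ≠ a := by
    intro y hy hya
    obtain ⟨l, hl⟩ := hPm y
    refine ha (play (e ≫ p) y).pebble ?_
    rw [← hl, position_append_of_forall_ne, Play.position_moves, hya]
    intro c hc
    exact hy (l ++ [(r, a)]) (by rw [← List.append_assoc, hl]) c (List.mem_append_left _ hc)
  have hQlin : ∀ x y : Q, x ≤ y ∨ y ≤ x := fun x y =>
    List.prefix_or_prefix_of_prefix (show Play.moves x.1 <+: t.moves from x.2)
      (show Play.moves y.1 <+: t.moves from y.2)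
  have hself : ∀ x : Q, ∀ l, Play.moves x.1 = Play.moves x.1 ++ l →
      ∀ c ∈ l, c.1 ≠ Play.pebble x.1 := by
    intro x l hl c hc
    simp only [List.self_eq_append_right] at hl
    simp [hl] at hc
  have hQI : ∀ x y : Q, RelMap (symI L) ![x, y] ↔
      (∀ l, Play.moves y.1 = Play.moves x.1 ++ l → ∀ c ∈ l, c.1 ≠ Play.pebble x.1) ∧
      (∀ l, Play.moves x.1 = Play.moves y.1 ++ l → ∀ c ∈ l, c.1 ≠ Play.pebble y.1) ∧
      Play.elem x.1 = Play.elem y.1 := by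
    intro x y
    have hxy : (fun j => Play.elem (![x, y] j).1) = ![Play.elem x.1, Play.elem y.1] := by
      funext j
      fin_cases j <;> rfl
    rw [← hI, ← hxy]
    refine ⟨fun h => ⟨h.2.1 0 1, h.2.1 1 0, h.2.2⟩, fun h => ⟨fun i j => hQlin _ _, ?_, h.2.2⟩⟩
    intro i j
    fin_cases i <;> fin_cases j
    · exact hself x
    · exact h.1
    · exact h.2.1
    · exact hself y
  -- Within the image of `P`, `I` is the identity because `P` is an embedded path; between that
  -- image and the top, `hfresh` excludes `I`.
  have hQpath : IsPath Q := by
    refine ⟨hQlin, fun x y => ⟨fun h => ?_, ?_⟩⟩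
    · obtain ⟨h₁, h₂, h₃⟩ := (hQI x y).1 h
      rcases hQ' x with rfl | ⟨x, rfl⟩ <;> rcases hQ' y with rfl | ⟨y, rfl⟩
      · rfl
      · exact absurd (h₃.symm.trans hta) (hfresh y h₂)
      · exact absurd (h₃.trans hta) (hfresh x h₁)
      · refine congrArg _ ((hP.2 x y).1 (hi.2 2 _ _ ?_))
        convert h using 1
        funext j
        fin_cases j <;> rfl
    · rintro rfl
      exact (hQI x x).2 ⟨hself x, hself x, rfl⟩
  obtain ⟨d, hd, hid, hdp⟩ := hp' P Q i e (incl _ T) hP hQpath hi he isEmbedding_incl rfl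
  have hpeb : (play (d ≫ q) top).pebble = r := (pebble_play top).trans htr
  -- Preservation of roots and covers makes the answer exactly one move long, and preservation of
  -- pebbles makes it a move of `r`.
  suffices hs : ∃ x, (play (d ≫ q) top).moves = m' ++ [x] by
    obtain ⟨x, hx⟩ := hs
    rw [(Play.pebble_elem_of_moves_eq hx).1] at hpeb
    refine ⟨x.2, Q, d, hQpath, hd, .inr ⟨top, fun y => y.2, ?_, by rw [hx, ← hpeb]⟩⟩
    rw [hdp]
    rfl
  obtain ⟨hP', rfl, rfl⟩ | ⟨z, hz, hzm, rfl⟩ := hz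
  · have hmin : IsMin top := isMin_sub.2 (Play.isMin_iff.2 rfl)
    exact List.length_eq_one_iff.1 (Play.isMin_iff.1 ((d ≫ q).map_root top hmin))
  · have hcov : i.toHom z ⋖ top :=
      covBy_sub.2 (Play.covBy_iff_exists.2 ⟨(r, a), congrArg (· ++ [(r, a)]) hzm.symm⟩)
    obtain ⟨x, hx⟩ := Play.covBy_iff_exists.1 ((d ≫ q).map_covBy _ _ hcov)
    have hdz : (d ≫ q).toHom (i.toHom z) = play (e ≫ q) z := by
      rw [← hid]
      rfl
    rw [hdz] at hx
    exact ⟨x, hx⟩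

end Reaches

end Reaches

/-! ### Formulas evaluated at corresponding positions -/

section Realize

theorem relMap_symI {L : FirstOrder.Language.{w, v}} (A : Type u) [L.Structure A] (x y : A) :
    (expandI L A).RelMap (symI L) ![x, y] ↔ x = y := Iff.rfl

variable {L : FirstOrder.Language.{w, v}} [L.IsRelational] {k : ℕ} {A B : Type u}
  [L.Structure A] [L.Structure B] {R : PebbleForest.{u} (plus L) k}
  {p : R ⟶ plays L k A} {q : R ⟶ plays L k B}

/-- `Reaches` for the plays on `L`-structures. -/
def ReachesPlays (p : R ⟶ plays L k A) (q : R ⟶ plays L k B) (m : List (Fin k × A))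
    (m' : List (Fin k × B)) : Prop :=
  @Reaches L _ k A B (expandI L A) (expandI L B) R p q m m'

theorem ReachesPlays.symm {m : List (Fin k × A)} {m' : List (Fin k × B)}
    (h : ReachesPlays p q m m') : ReachesPlays q p m' m :=
  @Reaches.symm L _ k A B (expandI L A) (expandI L B) R p q m m' h

/-- The variables other than `i` occupy at most `k - 1` pebbles. Were all pebbles occupied, choosing
a variable for each would be an injection of `Fin k` into itself that misses `i`. -/
theorem exists_free_pebble {S : Set (Fin k)} (ρ : S → Fin k) (i : Fin k) :
    ∃ r, ∀ j : S, (j : Fin k) ≠ i → ρ j ≠ r := by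
  by_contra! h
  choose g hgi hg using h
  have hinj : Function.Injective fun r => (g r : Fin k) := fun r r' hr => by
    rw [← hg r, ← hg r', Subtype.ext hr]
  obtain ⟨r, hr⟩ := Finite.injective_iff_surjective.1 hinj i
  exact hgi r hr

/-- Variables are evaluated at the elements on which the pebbles named by `ρ` are. When a variable
is given a new value, a new pebble is moved only if there is none on that element yet. -/
theorem ReachesPlays.exists_assign {m : List (Fin k × A)} {m' : List (Fin k × B)}
    (h : ReachesPlays p q m m') (hp : IsPathwiseEmbedding p) (hp' : IsOpenMorphism p)
    {S : Set (Fin k)} {ρ : S → Fin k} {v : S → A} {w : S → B}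
    (hv : ∀ j, position m (ρ j) = some (v j)) (hw : ∀ j, position m' (ρ j) = some (w j))
    (i : Fin k) (a : A) :
    ∃ (b : B) (n : List (Fin k × A)) (n' : List (Fin k × B))
      (τ : ↥(insert i S : Set (Fin k)) → Fin k), ReachesPlays p q n n' ∧
      (∀ j, position n (τ j) = some (assign v i a j)) ∧
      ∀ j, position n' (τ j) = some (assign w i b j) := by
  let := expandI L A
  let := expandI L B
  -- On an occupied element no move is made: `x_i` is redirected to the pebble there, and the answer
  -- is whatever that pebble marks in `B`.
  by_cases ha : ∃ r, position m r = some a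
  · obtain ⟨r, hr⟩ := ha
    obtain ⟨b, hb⟩ := Reaches.exists_position h hr
    refine ⟨b, m, m', assign ρ i r, h, fun j => ?_, fun j => ?_⟩ <;>
    · by_cases hj : (j : Fin k) = i
      · rwa [assign_of_eq _ _ hj, assign_of_eq _ _ hj]
      · rw [assign_of_ne _ _ hj, assign_of_ne _ _ hj]
        first | exact hv _ | exact hw _
  · push Not at ha
    obtain ⟨r, hr⟩ := exists_free_pebble ρ i
    obtain ⟨b, hb⟩ := Reaches.exists_append_singleton h (relMap_symI A) hp hp' r ha
    refine ⟨b, _, _, assign ρ i r, hb, fun j => ?_, fun j => ?_⟩ <;>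
    · rw [position_append_singleton]
      by_cases hj : (j : Fin k) = i
      · rw [assign_of_eq _ _ hj, assign_of_eq _ _ hj, Function.update_self]
      · rw [assign_of_ne _ _ hj, assign_of_ne _ _ hj, Function.update_of_ne (hr _ hj)]
        first | exact hv _ | exact hw _

/-- Positions and `ρ` must vary in the induction, since a quantifier changes them. Each direction of
a quantifier step uses one leg of the span, the other leg entering through `symm`. -/
theorem ReachesPlays.realize_iff (hp : IsPathwiseEmbedding p) (hp' : IsOpenMorphism p)
    (hq : IsPathwiseEmbedding q) (hq' : IsOpenMorphism q) {S : Set (Fin k)}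
    (φ : KFormula.{u} L k S) : ∀ {m : List (Fin k × A)} {m' : List (Fin k × B)} {ρ : S → Fin k}
      {v : S → A} {w : S → B}, ReachesPlays p q m m' → (∀ j, position m (ρ j) = some (v j)) →
      (∀ j, position m' (ρ j) = some (w j)) → (φ.Realize A v ↔ φ.Realize B w) := by
  induction φ with
  | equal i j =>
    intro m m' ρ v w h hv hw
    -- Equality of values is the relation `I`, so that two variables agree on `A` exactly when they
    -- agree on `B`, even if evaluated at different pebbles.
    refine @Reaches.relMap_iff L _ k A B (expandI L A) (expandI L B) R p q m m' h hp hq 2 (symI L)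
      ![ρ i, ρ j] ![v i, v j] ![w i, w j] ?_ ?_ <;>
    · intro l
      fin_cases l
      · first | exact hv i | exact hw i
      · first | exact hv j | exact hw j
  | rel T x =>
    intro m m' ρ v w h hv hw
    exact @Reaches.relMap_iff L _ k A B (expandI L A) (expandI L B) R p q m m' h hp hq _
      (Sum.inl T) _ _ _ (fun j => hv (x j)) fun j => hw (x j)
  | neg φ ih => exact fun h hv hw => not_congr (ih h hv hw)
  | conj φ ih => exact fun h hv hw => forall_congr' fun l => ih l h hv hw
  | disj φ ih => exact fun h hv hw => exists_congr fun l => ih l h hv hw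
  | ex i φ ih =>
    intro m m' ρ v w h hv hw
    constructor
    · rintro ⟨a, ha⟩
      obtain ⟨b, n, n', τ, hn, hnv, hnw⟩ := h.exists_assign hp hp' hv hw i a
      exact ⟨b, (ih hn hnv hnw).1 ha⟩
    · rintro ⟨b, hb⟩
      obtain ⟨a, n', n, τ, hn, hnw, hnv⟩ := h.symm.exists_assign hq hq' hw hv i b
      exact ⟨a, (ih hn.symm hnv hnw).2 hb⟩
  | all i φ ih =>
    intro m m' ρ v w h hv hw
    constructor
    · intro hA b
      obtain ⟨a, n', n, τ, hn, hnw, hnv⟩ := h.symm.exists_assign hq hq' hw hv i b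
      exact (ih hn.symm hnv hnw).1 (hA a)
    · intro hB a
      obtain ⟨b, n, n', τ, hn, hnv, hnw⟩ := h.exists_assign hp hp' hv hw i a
      exact (ih hn hnv hnw).2 (hB b)

theorem BackAndForth.kEquivalent (h : BackAndForth L k A B) : KEquivalent L k A B := by
  obtain ⟨R, p, q, hp', hp, hq', hq⟩ := h
  let := expandI L A
  let := expandI L B
  exact fun φ => ReachesPlays.realize_iff hp hp' hq hq' φ (ρ := fun i => i.2.elim)
    (reaches_nil p q) (fun i => i.2.elim) fun i => i.2.elim

end Realize

end PebbleGame

theorem mainTheorem6 (L : FirstOrder.Language.{w, v}) [L.IsRelational] [IsEmpty (L.Relations 0)]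
    (k : ℕ) (A B : Type u) [L.Structure A] [L.Structure B] :
    PebbleGame.KEquivalent L k A B ↔ PebbleGame.BackAndForth L k A B :=
  ⟨PebbleGame.KEquivalent.backAndForth, PebbleGame.BackAndForth.kEquivalent⟩
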